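/- Let $1\le N_T\le N_R$ be integers and $N=N_R-N_T+1$. Write ${}_1F_1(N;N_R;\sigma)=\sum_{n\ge0}A_n(\sigma)$ with $A_n(\sigma)=\frac{(N)_n}{(N_R)_n}\frac{\sigma^n}{n!}$, where $(x)_n=x(x+1)\cdots(x+n-1)$. For $a\ge0$ let $$M(s,a)=\frac1{(1-s)^N}\,{}_1F_1\!\Big(N;N_R;\frac{as}{1-s}\Big)\quad(s<1),\qquad p(t,a)=\sum_{n=0}^\infty A_n(a)\sum_{m=0}^n\binom nm\frac{(-1)^m\,t^{N+n-m-1}e^{-t}}{(N+n-m-1)!}\quad(t>0)$$ (the moment generating function and the probability density of the normalized signal-to-noise ratio, $\Gamma_1=1$, of the Rician-fading stream in MIMO zero-forcing detection with $N_T$ transmit and $N_R$ receive antennas under Rician–Rayleigh fading). Let $\mathbf p(t,a)=\big(p,\ \partial_tp,\ \partial_t^2p\big)^{\mathsf T}(t,a)$. Let $$\mathbf P(t,a)=\begin{pmatrix}0&1&0\\0&0&1\\ P_{31}&P_{32}&P_{33}\end{pmatrix},$$ $$P_{31}=\tfrac{(N_R-2)t+(N-1)(2-N_R-a)}{t^2},\quad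 P_{32}=-\tfrac{t^2+(6-2N-N_R-a)t+(N-1)(N-2)}{t^2},\quad P_{33}=-\tfrac{2t^2-(2N-4)t}{t^2},$$ and let $\mathbf Q(t,a)$ be the $3\times3$ matrix with first row $(-1,\ N-t-2,\ -t)$ and $$Q_{21}=2-N_R+\tfrac{2-2N-N_R-a+NN_R+Na}{t},\quad Q_{22}=4-2N-N_R-a+t+\tfrac{2+N^2-3N}{t},\quad Q_{23}=1-N+t,$$ $$Q_{31}=-2+N_R+\tfrac{-4+4N+2N_R+a-2NN_R-Na}{t}+\tfrac{-4+6N+2N_R+2a-3NN_R-3Na+N^2N_R+N^2a-2N^2}{t^2},$$ $$Q_{32}=3N-4+a-t+\tfrac{-6-3N^2+9N}{t}+\tfrac{-4+8N-5N^2+N^3}{t^2},\quad Q_{33}=-1+2N-N_R-a-t+\tfrac{-2-N^2+3N}{t}.$$ Then: 1. For every $a\ge0$ the series for $p(t,a)$ converges for all $t>0$, and $p(\cdot,a)$ is nonnegative and smooth on $(0,\infty)$. For every $s<1$ the series ${}_1F_1\big(N;N_R;\frac{as}{1-s}\big)$ converges, $e^{st}p(t,a)$ is integrable on $(0,\infty)$,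 and $\int_0^\infty e^{st}p(t,a)\,dt=M(s,a)$. In particular, $p(\cdot,a)$ is the probability density with moment generating function $M(\cdot,a)$. 2. For every $c\ge0$, along the line $a=ct$ the function $\tilde{\mathbf p}(u)=\mathbf p(u,cu)$ is differentiable on $(0,\infty)$ and satisfies the system of ordinary differential equations $$\tilde{\mathbf p}'(u)=\Big[\mathbf P(u,cu)+\tfrac1u\,\mathbf Q(u,cu)\Big]\tilde{\mathbf p}(u),\qquad u>0.$$ 3. (Holonomic gradient method.) For every $c\ge0$ and $0<u_0\le u_1$, any solution $\mathbf y$ of this system on $[u_0,u_1]$ with $\mathbf y(u_0)=\tilde{\mathbf p}(u_0)$ equals $\tilde{\mathbf p}$ on $[u_0,u_1]$; so solving the system numerically from the initial condition at $u_0$ computes $p(u,cu)$. -/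

import Mathlib

open scoped ContDiff

noncomputable section

namespace ZFSNR

/-- The `n`-th term `(N)_n / (NR)_n * σ ^ n / n!` of the confluent hypergeometric series. -/
def hypTerm (N NR n : ℕ) (σ : ℝ) : ℝ :=
  (ascPochhammer ℝ n).eval (N : ℝ) / (ascPochhammer ℝ n).eval (NR : ℝ) *
    (σ ^ n / (n.factorial : ℝ))

/-- The confluent hypergeometric function `₁F₁(N; NR; σ)`. -/
def confluentHyp (N NR : ℕ) (σ : ℝ) : ℝ :=
  ∑' n : ℕ, hypTerm N NR n σ

/-- The normalized SNR moment generating function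
`M(s, a) = (1 - s)⁻ᴺ ₁F₁(N; NR; a s / (1 - s))`, for `s < 1`. -/
def snrMgf (N NR : ℕ) (s a : ℝ) : ℝ :=
  1 / (1 - s) ^ N * confluentHyp N NR (a * s / (1 - s))

/-- The `n`-th term of the series for the normalized SNR density
(`N ≥ 1` and `m ≤ n`, so the natural-number subtractions are exact). -/
def pdfTerm (N NR : ℕ) (t a : ℝ) (n : ℕ) : ℝ :=
  hypTerm N NR n a * ∑ m ∈ Finset.range (n + 1),
    (n.choose m : ℝ) *
      ((-1) ^ m * t ^ (N + n - m - 1) * Real.exp (-t) / ((N + n - m - 1).factorial : ℝ))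

/-- The normalized SNR probability density `p(t, a)`, for `t > 0`. -/
def snrPdf (N NR : ℕ) (t a : ℝ) : ℝ :=
  ∑' n : ℕ, pdfTerm N NR t a n

/-- The function vector `(p, ∂ₜ p, ∂ₜ² p)` at `(t, a)`. -/
def pVec (N NR : ℕ) (t a : ℝ) : Fin 3 → ℝ :=
  fun q => iteratedDeriv (q : ℕ) (fun τ => snrPdf N NR τ a) t

/-- The companion matrix `P(t, a)`. -/
def matP (N NR : ℝ) (t a : ℝ) : Matrix (Fin 3) (Fin 3) ℝ :=
  !![0, 1, 0;
     0, 0, 1;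
     ((NR - 2) * t + (N - 1) * (2 - NR - a)) / t ^ 2,
     -((t ^ 2 + (6 - 2 * N - NR - a) * t) / t ^ 2) - (N - 1) * (N - 2) / t ^ 2,
     -((2 * t ^ 2 - (2 * N - 4) * t) / t ^ 2)]

/-- The matrix `Q(t, a)`. -/
def matQ (N NR : ℝ) (t a : ℝ) : Matrix (Fin 3) (Fin 3) ℝ :=
  !![-1, N - t - 2, -t;
     2 - NR + (2 - 2 * N - NR - a + N * NR + N * a) / t,
     4 - 2 * N - NR - a + t + (2 + N ^ 2 - 3 * N) / t,
     1 - N + t;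
     -2 + NR + (-4 + 4 * N + 2 * NR) / t + (a - 2 * N * NR - N * a) / t
       + (-4 + 6 * N + 2 * NR + 2 * a - 3 * N * NR - 3 * N * a) / t ^ 2
       + (N ^ 2 * NR + N ^ 2 * a - 2 * N ^ 2) / t ^ 2,
     3 * N - 4 + a - t + (-6 - 3 * N ^ 2 + 9 * N) / t
       + (-4 + 8 * N - 5 * N ^ 2 + N ^ 3) / t ^ 2,
     -1 + 2 * N - NR - a - t + (-2 - N ^ 2 + 3 * N) / t]

/-- The function vector on the line `a = c t`. -/
def pLine (N NR : ℕ) (c u : ℝ) : Fin 3 → ℝ :=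
  pVec N NR u (c * u)

/-- The coefficient matrix `P(u, cu) + (1/u) Q(u, cu)` of the system on the line `a = c t`. -/
def lineMatrix (N NR : ℕ) (c u : ℝ) : Matrix (Fin 3) (Fin 3) ℝ :=
  matP N NR u (c * u) + (1 / u) • matQ N NR u (c * u)

end ZFSNR

end

/-!
Write `α = N` and `γ = N_R`. Expanding the binomial sums and collecting the Gamma densities of equal
shape turns `p(·, a)` into a mixture of the Gamma densities of shape `α + k`, with weights
`(α)_k / (γ)_k * a ^ k / k! * ₁F₁(α + k; γ + k; -a)`. By Kummer's transformation, a consequence of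
the Chu–Vandermonde identity, these equal
`e ^ (-a) * (α)_k / (γ)_k * a ^ k / k! * ₁F₁(γ - α; γ + k; a)`, which is nonnegative for `a ≥ 0`.
A Gamma density of shape `α + k` has moment generating function `(1 - s) ^ (-(α + k))`, so
integrating the mixture term by term gives `M(s, a)`.

The same mixture sums to an elementary factor times Humbert's entire function
`Φ₃(γ - α; γ; a, a t)`. The derivatives of `Φ₃` are combinations of functions with `γ` shifted by an
integer, and Euler's identity for its homogeneous parts is a linear relation between four
consecutive shifts. So `p`, `∂ₜp`, `∂ₜ²p` span a module closed under differentiation, which is the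
Pfaffian system `d𝐩 = (𝐏 dt + 𝐐 da / a) 𝐩`. Its restriction to `a = c t` is the system of ordinary
differential equations, and solutions of a linear system are unique by Grönwall's inequality.
-/

noncomputable section

open Real MeasureTheory ProbabilityTheory

namespace ZFSNR

/-! ### Everywhere convergent double power series -/

section DoublePowerSeries

variable {𝕜 : Type*} [RCLike 𝕜]

/-- The differential of the monomial `z ↦ z.1 ^ m * z.2 ^ n` at `z`. -/
def monomialFDeriv (m n : ℕ) (z : 𝕜 × 𝕜) : 𝕜 × 𝕜 →L[𝕜] 𝕜 :=
  (m * z.1 ^ (m - 1) * z.2 ^ n) • ContinuousLinearMap.fst 𝕜 𝕜 𝕜 +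
    (z.1 ^ m * (n * z.2 ^ (n - 1))) • ContinuousLinearMap.snd 𝕜 𝕜 𝕜

theorem hasFDerivAt_pow_mul_pow (m n : ℕ) (z : 𝕜 × 𝕜) :
    HasFDerivAt (fun z : 𝕜 × 𝕜 => z.1 ^ m * z.2 ^ n) (monomialFDeriv m n z) z := by
  refine ((hasFDerivAt_fst.pow m).mul (hasFDerivAt_snd.pow n)).congr_fderiv ?_
  ext <;> simp [monomialFDeriv]; ring

theorem norm_monomialFDeriv_le {R : ℝ} (hR : 1 ≤ R) (m n : ℕ) {z : 𝕜 × 𝕜} (hz : ‖z‖ ≤ R) :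
    ‖monomialFDeriv m n z‖ ≤ (2 * R) ^ (m + n) := by
  have hpow {w : 𝕜} (hw : ‖w‖ ≤ R) (k : ℕ) : ‖w ^ k‖ ≤ R ^ k := by
    rw [norm_pow]; gcongr
  have hpred {w : 𝕜} (hw : ‖w‖ ≤ R) (k : ℕ) : ‖(k : 𝕜) * w ^ (k - 1)‖ ≤ k * R ^ k := by
    rw [norm_mul, RCLike.norm_natCast]
    gcongr
    exact (hpow hw _).trans (pow_le_pow_right₀ hR (Nat.sub_le k 1))
  have hz1 := (norm_fst_le z).trans hz
  have hz2 := (norm_snd_le z).trans hz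
  calc ‖monomialFDeriv m n z‖
      ≤ m * R ^ m * R ^ n * 1 + R ^ m * (n * R ^ n) * 1 := by
        refine (norm_add_le _ _).trans ?_
        rw [norm_smul, norm_smul, norm_mul, norm_mul (z.1 ^ m)]
        gcongr
        · exact hpred hz1 m
        · exact hpow hz2 n
        · exact ContinuousLinearMap.norm_fst_le 𝕜 𝕜 𝕜
        · exact hpow hz1 m
        · exact hpred hz2 n
        · exact ContinuousLinearMap.norm_snd_le 𝕜 𝕜 𝕜
    _ = (m + n : ℕ) * R ^ (m + n) := by push_cast; ring
    _ ≤ (2 * R) ^ (m + n) := by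
        rw [mul_pow]
        gcongr
        exact_mod_cast Nat.lt_two_pow_self.le

variable {ι : Type*} {C : ι → 𝕜} {m n : ι → ℕ}

theorem summable_mul_pow_mul_pow (hC : ∀ R : ℝ, Summable fun i => ‖C i‖ * R ^ (m i + n i))
    (x y : 𝕜) : Summable fun i => C i * (x ^ m i * y ^ n i) := by
  refine .of_norm_bounded (hC ‖(x, y)‖) fun i => ?_
  rw [norm_mul, norm_mul, norm_pow, norm_pow, pow_add]
  gcongr
  · exact norm_fst_le (x, y)
  · exact norm_snd_le (x, y)

theorem hasFDerivAt_tsum_mul_pow_mul_pow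
    (hC : ∀ R : ℝ, Summable fun i => ‖C i‖ * R ^ (m i + n i)) {x y Dx Dy : 𝕜}
    (hx : HasSum (fun i => C i * (m i * x ^ (m i - 1) * y ^ n i)) Dx)
    (hy : HasSum (fun i => C i * (x ^ m i * (n i * y ^ (n i - 1)))) Dy) :
    HasFDerivAt (fun z : 𝕜 × 𝕜 => ∑' i, C i * (z.1 ^ m i * z.2 ^ n i))
      (Dx • ContinuousLinearMap.fst 𝕜 𝕜 𝕜 + Dy • ContinuousLinearMap.snd 𝕜 𝕜 𝕜) (x, y) := by
  set R : ℝ := ‖(x, y)‖ + 1 with hR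
  have hR1 : 1 ≤ R := le_add_of_nonneg_left (norm_nonneg _)
  have hmem : (x, y) ∈ Metric.ball (0 : 𝕜 × 𝕜) R := by simp [hR]
  have hbound (i : ι) (z : 𝕜 × 𝕜) (hz : z ∈ Metric.ball 0 R) :
      ‖C i • monomialFDeriv (m i) (n i) z‖ ≤ ‖C i‖ * (2 * R) ^ (m i + n i) := by
    rw [norm_smul]
    gcongr
    exact norm_monomialFDeriv_le hR1 _ _ (mem_ball_zero_iff.1 hz).le
  have hsum : HasSum (fun i => C i • monomialFDeriv (m i) (n i) (x, y))
      (Dx • ContinuousLinearMap.fst 𝕜 𝕜 𝕜 + Dy • ContinuousLinearMap.snd 𝕜 𝕜 𝕜) := by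
    simpa only [monomialFDeriv, smul_add, smul_smul] using (hx.smul_const _).add (hy.smul_const _)
  rw [← hsum.tsum_eq]
  exact hasFDerivAt_tsum_of_isPreconnected (hC (2 * R)) Metric.isOpen_ball
    (convex_ball _ _).isPreconnected
    (fun i z _ => (hasFDerivAt_pow_mul_pow (m i) (n i) z).const_mul (C i)) hbound hmem
    (summable_mul_pow_mul_pow hC x y) hmem

end DoublePowerSeries

/-! ### The Humbert function -/

theorem inv_Gamma_eq_mul_inv_Gamma_add_one (s : ℝ) : (Gamma s)⁻¹ = s * (Gamma (s + 1))⁻¹ := by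
  rcases eq_or_ne s 0 with rfl | hs
  · simp
  · rw [Gamma_add_one hs]; field_simp

theorem summable_pow_div_Gamma_add (c R : ℝ) : Summable fun n : ℕ => R ^ n / Gamma (c + n) := by
  refine summable_of_ratio_norm_eventually_le one_half_lt_one ?_
  have hlarge : ∀ᶠ n : ℕ in Filter.atTop, 2 * |R| + 1 ≤ c + n :=
    (Filter.tendsto_atTop_add_const_left _ c tendsto_natCast_atTop_atTop).eventually_ge_atTop _
  filter_upwards [hlarge] with n hn
  have hpos : 0 < c + n := by linarith [abs_nonneg R]
  have hstep : R ^ (n + 1) / Gamma (c + ↑(n + 1)) = R / (c + n) * (R ^ n / Gamma (c + n)) := by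
    rw [div_eq_mul_inv _ (Gamma (c + n)), inv_Gamma_eq_mul_inv_Gamma_add_one (c + n),
      Nat.cast_succ, ← add_assoc]
    field_simp
    ring
  rw [hstep, norm_mul]
  gcongr
  rw [Real.norm_eq_abs, abs_div, abs_of_pos hpos, div_le_iff₀ hpos]
  linarith

theorem abs_ascPochhammer_eval_le (b : ℝ) (n : ℕ) :
    |(ascPochhammer ℝ n).eval b| ≤ n.factorial * (|b| + 1) ^ n := by
  induction n with
  | zero => simp
  | succ n ih =>
    rw [ascPochhammer_succ_eval, abs_mul, Nat.factorial_succ, pow_succ]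
    have hfactor : |b + n| ≤ (n + 1) * (|b| + 1) := by
      have h := abs_add_le b n
      rw [Nat.abs_cast] at h
      nlinarith [mul_nonneg n.cast_nonneg (abs_nonneg b)]
    calc _ ≤ n.factorial * (|b| + 1) ^ n * ((n + 1) * (|b| + 1)) := by gcongr
      _ = _ := by push_cast; ring

/-- The coefficient `(b)_j / (Γ(c + j + k) j! k!)` of `x ^ j * y ^ k` in the Humbert series. The
junk value `Γ(-n) = 0` agrees with the convention `1 / Γ(-n) = 0`, so every real `c` is allowed. -/
def humbertCoeff (b c : ℝ) (i : ℕ × ℕ) : ℝ :=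
  (ascPochhammer ℝ i.1).eval b / (Gamma (c + i.1 + i.2) * i.1.factorial * i.2.factorial)

/-- The regularized Humbert function `Φ₃(b; c; x, y) / Γ(c)`. The normalization makes `∂/∂y` the
shift `c ↦ c + 1`. -/
def humbert (b c x y : ℝ) : ℝ :=
  ∑' i : ℕ × ℕ, humbertCoeff b c i * (x ^ i.1 * y ^ i.2)

theorem humbertCoeff_eq_mul (b c : ℝ) (i : ℕ × ℕ) :
    humbertCoeff b c i = (c + i.1 + i.2) * humbertCoeff b (c + 1) i := by
  simp only [humbertCoeff, div_eq_mul_inv, mul_inv]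
  rw [inv_Gamma_eq_mul_inv_Gamma_add_one,
    show c + i.1 + i.2 + 1 = c + 1 + (i.1 : ℝ) + i.2 by ring]
  ring

theorem succ_mul_humbertCoeff_succ_left (b c : ℝ) (j k : ℕ) :
    (j + 1 : ℝ) * humbertCoeff b c (j + 1, k) = (b + j) * humbertCoeff b (c + 1) (j, k) := by
  simp only [humbertCoeff, ascPochhammer_succ_eval, Nat.factorial_succ, Nat.cast_mul, Nat.cast_succ]
  rw [show c + ((j : ℝ) + 1) + k = c + 1 + j + k by ring]
  field_simp

theorem succ_mul_humbertCoeff_succ_right (b c : ℝ) (j k : ℕ) :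
    (k + 1 : ℝ) * humbertCoeff b c (j, k + 1) = humbertCoeff b (c + 1) (j, k) := by
  simp only [humbertCoeff, Nat.factorial_succ, Nat.cast_mul, Nat.cast_succ]
  rw [show c + j + ((k : ℝ) + 1) = c + 1 + j + k by ring]
  field_simp

theorem abs_humbertCoeff_le (b c : ℝ) (i : ℕ × ℕ) :
    |humbertCoeff b c i| ≤ (|b| + 1) ^ i.1 / |Gamma (c + i.1 + i.2)| / i.2.factorial := by
  calc |humbertCoeff b c i|
      = |(ascPochhammer ℝ i.1).eval b| / i.1.factorial / |Gamma (c + i.1 + i.2)| /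
          i.2.factorial := by
        simp only [humbertCoeff, abs_div, abs_mul, Nat.abs_cast]
        ring
    _ ≤ (|b| + 1) ^ i.1 / |Gamma (c + i.1 + i.2)| / i.2.factorial := by
        gcongr
        rw [div_le_iff₀' (by positivity)]
        exact abs_ascPochhammer_eval_le b i.1

theorem summable_norm_humbertCoeff_mul_pow (b c R : ℝ) :
    Summable fun i : ℕ × ℕ => ‖humbertCoeff b c i‖ * R ^ (i.1 + i.2) := by
  set B : ℝ := |b| + 1
  have hB : 1 ≤ B := le_add_of_nonneg_left (abs_nonneg b)
  set S : ℝ := 2 * B * (|R| + 1) with hS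
  obtain ⟨M, hM⟩ := (summable_pow_div_Gamma_add c S).tendsto_atTop_zero.norm.bddAbove_range
  have hsum : Summable fun i : ℕ × ℕ => M * ((1 / 2 : ℝ) ^ i.1 * (1 ^ i.2 / i.2.factorial)) :=
    (summable_geometric_two.mul_of_nonneg (summable_pow_div_factorial 1)
      (fun _ => by positivity) (fun _ => by positivity)).mul_left M
  refine .of_norm_bounded hsum fun ⟨j, k⟩ => ?_
  have hgrowth : B ^ j * |R| ^ (j + k) ≤ S ^ (j + k) * (1 / 2) ^ j := by
    have hk : |R| ^ (j + k) ≤ (|R| + 1) ^ (j + k) := by gcongr; linarith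
    have hj : 1 ≤ (2 * B) ^ k := one_le_pow₀ (by linarith)
    calc B ^ j * |R| ^ (j + k) ≤ B ^ j * ((2 * B) ^ k * (|R| + 1) ^ (j + k)) := by
          gcongr; exact hk.trans (le_mul_of_one_le_left (by positivity) hj)
      _ = S ^ (j + k) * (1 / 2) ^ j := by
          rw [hS, mul_pow _ (|R| + 1), pow_add (2 * B), mul_pow 2 B j, one_div, inv_pow]
          field_simp
  have hMjk : S ^ (j + k) / |Gamma (c + j + k)| ≤ M := by
    have h : ‖S ^ (j + k) / Gamma (c + (j + k : ℕ))‖ ≤ M := hM ⟨j + k, rfl⟩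
    rwa [Real.norm_eq_abs, abs_div, abs_of_nonneg (by positivity), Nat.cast_add, ← add_assoc] at h
  rw [norm_mul, norm_norm, norm_pow, Real.norm_eq_abs, Real.norm_eq_abs]
  calc |humbertCoeff b c (j, k)| * |R| ^ (j + k)
      ≤ B ^ j / |Gamma (c + j + k)| / k.factorial * |R| ^ (j + k) := by
        gcongr; exact abs_humbertCoeff_le b c (j, k)
    _ = B ^ j * |R| ^ (j + k) / |Gamma (c + j + k)| / k.factorial := by ring
    _ ≤ S ^ (j + k) * (1 / 2) ^ j / |Gamma (c + j + k)| / k.factorial := by gcongr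
    _ = S ^ (j + k) / |Gamma (c + j + k)| * ((1 / 2) ^ j * (1 ^ k / k.factorial)) := by
        rw [one_pow]; ring
    _ ≤ M * ((1 / 2) ^ j * (1 ^ k / k.factorial)) := by gcongr

theorem hasSum_humbert (b c x y : ℝ) :
    HasSum (fun i : ℕ × ℕ => humbertCoeff b c i * (x ^ i.1 * y ^ i.2)) (humbert b c x y) :=
  (summable_mul_pow_mul_pow (summable_norm_humbertCoeff_mul_pow b c) x y).hasSum

theorem hasSum_of_hasSum_succ_fst {ι M : Type*} [AddCommMonoid M] [TopologicalSpace M]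
    {f : ℕ × ι → M} {s : M} (h0 : ∀ k, f (0, k) = 0)
    (h : HasSum (fun i : ℕ × ι => f (i.1 + 1, i.2)) s) : HasSum f s := by
  have hinj : Function.Injective fun i : ℕ × ι => (i.1 + 1, i.2) := fun i j hij => by
    simpa [Prod.ext_iff] using hij
  refine (hinj.hasSum_iff fun i hi => ?_).1 h
  rcases i with ⟨_ | j, k⟩
  · exact h0 k
  · exact absurd ⟨(j, k), rfl⟩ hi

theorem hasSum_of_hasSum_succ_snd {ι M : Type*} [AddCommMonoid M] [TopologicalSpace M]
    {f : ι × ℕ → M} {s : M} (h0 : ∀ j, f (j, 0) = 0)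
    (h : HasSum (fun i : ι × ℕ => f (i.1, i.2 + 1)) s) : HasSum f s := by
  rw [← Prod.swap_bijective.injective.hasSum_iff (by simp [Prod.swap_surjective.range_eq])]
  exact hasSum_of_hasSum_succ_fst h0 ((Equiv.prodComm ℕ ι).hasSum_iff.2 h)

theorem hasSum_humbert_deriv_snd (b c x y : ℝ) :
    HasSum (fun i : ℕ × ℕ => humbertCoeff b c i * (x ^ i.1 * (i.2 * y ^ (i.2 - 1))))
      (humbert b (c + 1) x y) := by
  refine hasSum_of_hasSum_succ_snd (by simp) ((hasSum_humbert b (c + 1) x y).congr_fun ?_)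
  rintro ⟨j, k⟩
  simp only [← succ_mul_humbertCoeff_succ_right, Nat.add_sub_cancel, Nat.cast_succ]
  ring

theorem hasSum_snd_mul_humbert (b c x y : ℝ) :
    HasSum (fun i : ℕ × ℕ => i.2 * (humbertCoeff b c i * (x ^ i.1 * y ^ i.2)))
      (y * humbert b (c + 1) x y) := by
  refine ((hasSum_humbert_deriv_snd b c x y).mul_left y).congr_fun ?_
  rintro ⟨j, _ | k⟩
  · simp
  · simp only [Nat.add_sub_cancel]; ring

/-- The `x`-derivative of the regularized Humbert function `Φ₃(b; c; x, y) / Γ(c)`, in terms of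
functions with the same `b`. -/
def humbertDerivFst (b c x y : ℝ) : ℝ :=
  humbert b c x y + (b - c) * humbert b (c + 1) x y - y * humbert b (c + 2) x y

theorem hasSum_humbert_deriv_fst (b c x y : ℝ) :
    HasSum (fun i : ℕ × ℕ => humbertCoeff b c i * (i.1 * x ^ (i.1 - 1) * y ^ i.2))
      (humbertDerivFst b c x y) := by
  have hsum := ((hasSum_humbert b c x y).add ((hasSum_humbert b (c + 1) x y).mul_left (b - c))).sub
    (hasSum_snd_mul_humbert b (c + 1) x y)
  rw [show c + 1 + 1 = c + 2 by ring] at hsum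
  refine hasSum_of_hasSum_succ_fst (by simp) (hsum.congr_fun ?_)
  rintro ⟨j, k⟩
  have hleft := succ_mul_humbertCoeff_succ_left b c j k
  have hshift := humbertCoeff_eq_mul b c (j, k)
  simp only [Nat.add_sub_cancel, Nat.cast_succ] at hshift ⊢
  linear_combination x ^ j * y ^ k * (hleft - hshift)

theorem humbert_eq_add_mul_deriv (b c x y : ℝ) :
    humbert b c x y =
      c * humbert b (c + 1) x y + x * humbertDerivFst b (c + 1) x y +
        y * humbert b (c + 2) x y := by
  have hfst := (hasSum_humbert_deriv_fst b (c + 1) x y).mul_left x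
  have hsnd := hasSum_snd_mul_humbert b (c + 1) x y
  rw [show c + 1 + 1 = c + 2 by ring] at hsnd
  refine (hasSum_humbert b c x y).unique
    (((((hasSum_humbert b (c + 1) x y).mul_left c).add hfst).add hsnd).congr_fun ?_)
  rintro ⟨_ | j, k⟩
  · simp only [humbertCoeff_eq_mul b c]; push_cast; ring
  · simp only [humbertCoeff_eq_mul b c, Nat.add_sub_cancel]; ring

theorem hasFDerivAt_humbert (b c : ℝ) (z : ℝ × ℝ) :
    HasFDerivAt (fun z : ℝ × ℝ => humbert b c z.1 z.2)
      (humbertDerivFst b c z.1 z.2 • ContinuousLinearMap.fst ℝ ℝ ℝ +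
        humbert b (c + 1) z.1 z.2 • ContinuousLinearMap.snd ℝ ℝ ℝ) z :=
  hasFDerivAt_tsum_mul_pow_mul_pow (summable_norm_humbertCoeff_mul_pow b c)
    (hasSum_humbert_deriv_fst b c z.1 z.2) (hasSum_humbert_deriv_snd b c z.1 z.2)

theorem contDiff_humbert (b c : ℝ) : ContDiff ℝ ∞ fun z : ℝ × ℝ => humbert b c z.1 z.2 := by
  rw [contDiff_infty]
  intro n
  induction n generalizing c with
  | zero =>
    exact contDiff_zero.2
      (continuous_iff_continuousAt.2 fun z => (hasFDerivAt_humbert b c z).continuousAt)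
  | succ n ih =>
    refine contDiff_succ_iff_hasFDerivAt.2 ⟨_, ?_, hasFDerivAt_humbert b c⟩
    unfold humbertDerivFst
    exact ((((ih c).add (contDiff_const.mul (ih (c + 1)))).sub
      (contDiff_snd.mul (ih (c + 2)))).smul contDiff_const).add
      ((ih (c + 1)).smul contDiff_const)

theorem hasDerivAt_humbert_comp (b c : ℝ) {f g : ℝ → ℝ} {f' g' u : ℝ} (hf : HasDerivAt f f' u)
    (hg : HasDerivAt g g' u) :
    HasDerivAt (fun v => humbert b c (f v) (g v))
      (humbertDerivFst b c (f u) (g u) * f' + humbert b (c + 1) (f u) (g u) * g') u := by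
  have h := (hasFDerivAt_humbert b c (f u, g u)).comp_hasDerivAt u (hf.prodMk hg)
  simpa [Function.comp_def] using h

/-! ### The Pfaffian system of the density -/

/-- The `k`-th derivative of `t ↦ humbert b c a (a * t)`. -/
def humbertJet (b c : ℝ) (k : ℕ) (t a : ℝ) : ℝ :=
  a ^ k * humbert b (c + k) a (a * t)

theorem mul_humbertJet_add_three (b c : ℝ) (k : ℕ) (t a : ℝ) :
    t * humbertJet b c (k + 3) t a = -a * humbertJet b c k t a +
      (c + k + a) * humbertJet b c (k + 1) t a +
        (t + b - c - k - 1) * humbertJet b c (k + 2) t a := by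
  have heuler := humbert_eq_add_mul_deriv b (c + k) a (a * t)
  simp only [humbertDerivFst, humbertJet] at heuler ⊢
  push_cast
  rw [show c + k + 1 + 1 = c + (k + 2) by ring, show c + k + 1 + 2 = c + (k + 3) by ring,
    show c + k + 1 = c + (k + 1) by ring, show c + k + 2 = c + (k + 2) by ring] at heuler
  linear_combination a ^ (k + 1) * heuler

theorem hasDerivAt_humbertJet (b c : ℝ) (k : ℕ) {t a : ℝ → ℝ} {τ ρ u : ℝ}
    (ht : HasDerivAt t τ u) (ha : HasDerivAt a (a u * ρ) u) :
    HasDerivAt (fun v => humbertJet b c k (t v) (a v))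
      (τ * humbertJet b c (k + 1) (t u) (a u) +
        ρ * ((k + a u) * humbertJet b c k (t u) (a u) +
          (t u + b - c - k) * humbertJet b c (k + 1) (t u) (a u) -
            t u * humbertJet b c (k + 2) (t u) (a u))) u := by
  refine ((ha.fun_pow k).fun_mul
    (hasDerivAt_humbert_comp b (c + k) ha (ha.fun_mul ht))).congr_deriv ?_
  simp only [humbertDerivFst, humbertJet]
  push_cast
  rw [show c + k + 1 = c + (k + 1) by ring, show c + k + 2 = c + (k + 2) by ring]
  rcases k with _ | k
  · simp only [pow_zero]; push_cast; ring
  · rw [Nat.add_sub_cancel]; ring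

theorem hasDerivAt_humbertJet_succ (b c : ℝ) (k : ℕ) {t a : ℝ → ℝ} {τ ρ u : ℝ}
    (ht : HasDerivAt t τ u) (ha : HasDerivAt a (a u * ρ) u) :
    HasDerivAt (fun v => humbertJet b c (k + 1) (t v) (a v))
      (τ * humbertJet b c (k + 2) (t u) (a u) +
        ρ * (a u * humbertJet b c k (t u) (a u) +
          (1 - c) * humbertJet b c (k + 1) (t u) (a u))) u := by
  refine (hasDerivAt_humbertJet b c (k + 1) ht ha).congr_deriv ?_
  push_cast
  linear_combination -ρ * mul_humbertJet_add_three b c k (t u) (a u)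

/-- The elementary factor `Γ(γ) / Γ(α) * e ^ (-a) * t ^ (α - 1) * e ^ (-t)` of the density. -/
def densityWeight (α γ t a : ℝ) : ℝ :=
  Gamma γ / Gamma α * (exp (-a) * (t ^ (α - 1) * exp (-t)))

/-- The logarithmic `t`-derivative of `densityWeight`. -/
def densityLogDeriv (α t : ℝ) : ℝ := (α - 1) / t - 1

/-- The density `p(t, a)` and its first two `t`-derivatives in closed form, for real parameters
`α = N` and `γ = N_R`. -/
def densityJet (α γ t a : ℝ) : Fin 3 → ℝ :=
  let e := densityLogDeriv α t
  let h k := humbertJet (γ - α) γ k t a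
  densityWeight α γ t a •
    ![h 0, e * h 0 + h 1, (e ^ 2 - (α - 1) / t ^ 2) * h 0 + 2 * e * h 1 + h 2]

theorem hasDerivAt_densityWeight (α γ : ℝ) {t a : ℝ → ℝ} {τ ρ u : ℝ}
    (ht : HasDerivAt t τ u) (ha : HasDerivAt a (a u * ρ) u) (h0 : 0 < t u) :
    HasDerivAt (fun v => densityWeight α γ (t v) (a v))
      (densityWeight α γ (t u) (a u) * (τ * densityLogDeriv α (t u) - ρ * a u)) u := by
  refine ((ha.fun_neg.exp.fun_mul ((ht.rpow_const (p := α - 1) (.inl h0.ne')).fun_mul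
    ht.fun_neg.exp)).const_mul (Gamma γ / Gamma α)).congr_deriv ?_
  rw [densityWeight, densityLogDeriv, rpow_sub_one h0.ne' (α - 1)]
  ring

theorem hasDerivAt_densityLogDeriv (α : ℝ) {t : ℝ → ℝ} {τ u : ℝ} (ht : HasDerivAt t τ u)
    (h0 : t u ≠ 0) :
    HasDerivAt (fun v => densityLogDeriv α (t v)) (-τ * ((α - 1) / t u ^ 2)) u := by
  refine (((ht.fun_inv h0).const_mul (α - 1)).sub_const 1).congr_deriv ?_
  ring

theorem hasDerivAt_densityJet (α γ : ℝ) {t a : ℝ → ℝ} {τ ρ u : ℝ}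
    (ht : HasDerivAt t τ u) (ha : HasDerivAt a (a u * ρ) u) (h0 : 0 < t u) :
    HasDerivAt (fun v => densityJet α γ (t v) (a v))
      ((τ • matP α γ (t u) (a u) + ρ • matQ α γ (t u) (a u)).mulVec
        (densityJet α γ (t u) (a u))) u := by
  have ht0 := h0.ne'
  have hw := hasDerivAt_densityWeight α γ ht ha h0
  have he := hasDerivAt_densityLogDeriv α ht ht0
  have he' := ((ht.fun_pow 2).fun_inv (pow_ne_zero 2 ht0)).const_mul (α - 1)
  have hh0 := hasDerivAt_humbertJet (γ - α) γ 0 ht ha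
  have hh1 := hasDerivAt_humbertJet_succ (γ - α) γ 0 ht ha
  have hh2 := hasDerivAt_humbertJet_succ (γ - α) γ 1 ht ha
  have hh3 : humbertJet (γ - α) γ 3 (t u) (a u) = _ :=
    eq_div_of_mul_eq ht0 ((mul_comm _ _).trans (mul_humbertJet_add_three (γ - α) γ 0 (t u) (a u)))
  rw [hasDerivAt_pi]
  intro q
  fin_cases q
  · refine (hw.fun_mul hh0).congr_deriv ?_
    simp [matP, matQ, densityJet, Matrix.mulVec, dotProduct, Fin.sum_univ_three, densityLogDeriv]
    field_simp
    ring
  · refine (hw.fun_mul ((he.fun_mul hh0).fun_add hh1)).congr_deriv ?_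
    simp [matP, matQ, densityJet, Matrix.mulVec, dotProduct, Fin.sum_univ_three, densityLogDeriv]
    field_simp
    ring
  · refine (hw.fun_mul (((((he.fun_pow 2).fun_sub he').fun_mul hh0).fun_add
      ((he.const_mul 2).fun_mul hh1)).fun_add hh2)).congr_deriv ?_
    simp [matP, matQ, densityJet, Matrix.mulVec, dotProduct, Fin.sum_univ_three, densityLogDeriv,
      hh3]
    field_simp
    ring

/-! ### Kummer's confluent hypergeometric function -/

/-- The ratio `(α)_n / (γ)_n` of rising factorials. -/
def pochRatio (α γ : ℝ) (n : ℕ) : ℝ :=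
  (ascPochhammer ℝ n).eval α / (ascPochhammer ℝ n).eval γ

/-- Kummer's confluent hypergeometric function `₁F₁(α; γ; x)` with real parameters. -/
def kummerM (α γ x : ℝ) : ℝ :=
  ∑' n : ℕ, pochRatio α γ n * (x ^ n / (n.factorial : ℝ))

theorem pochRatio_zero (α γ : ℝ) : pochRatio α γ 0 = 1 := by simp [pochRatio]

theorem pochRatio_succ (α γ : ℝ) (n : ℕ) :
    pochRatio α γ (n + 1) = pochRatio α γ n * ((α + n) / (γ + n)) := by
  simp only [pochRatio, ascPochhammer_succ_eval, mul_div_mul_comm]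

theorem pochRatio_add (α γ : ℝ) (k n : ℕ) :
    pochRatio α γ (k + n) = pochRatio α γ k * pochRatio (α + k) (γ + k) n := by
  induction n with
  | zero => simp [pochRatio_zero]
  | succ n ih =>
    rw [← Nat.add_assoc, pochRatio_succ, ih, pochRatio_succ]
    push_cast
    ring_nf

theorem pochRatio_succ' (α γ : ℝ) (n : ℕ) :
    pochRatio α γ (n + 1) = α / γ * pochRatio (α + 1) (γ + 1) n := by
  simpa [add_comm 1 n, pochRatio_succ α γ 0, pochRatio_zero] using pochRatio_add α γ 1 n

theorem add_mul_pochRatio_add_one (δ : ℝ) {γ : ℝ} (hγ : ∀ k : ℕ, γ + k ≠ 0) (n : ℕ) :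
    (γ + n) * pochRatio δ (γ + 1) n = γ * pochRatio δ γ n := by
  induction n with
  | zero => simp [pochRatio_zero]
  | succ n ih =>
    have h1 := hγ (n + 1)
    have h2 := hγ n
    rw [pochRatio_succ, pochRatio_succ]
    push_cast at h1 ⊢
    rw [show γ + 1 + n = γ + (n + 1) by ring]
    field_simp
    linear_combination (δ + n) * ih

theorem sum_choose_mul_neg_one_pow_mul_pochRatio (α : ℝ) {γ : ℝ} (hγ : ∀ k : ℕ, γ + k ≠ 0)
    (n : ℕ) :
    ∑ m ∈ Finset.range (n + 1), (n.choose m : ℝ) * ((-1) ^ m * pochRatio α γ m) =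
      pochRatio (γ - α) γ n := by
  induction n generalizing α γ with
  | zero => simp [pochRatio_zero]
  | succ n ih =>
    have hγ' (k : ℕ) : γ + 1 + k ≠ 0 := by
      simpa [add_assoc, add_comm (1 : ℝ)] using hγ (k + 1)
    have hshift (m : ℕ) : (n.choose m : ℝ) * ((-1) ^ (m + 1) * pochRatio α γ (m + 1)) =
        -(α / γ) * (n.choose m * ((-1) ^ m * pochRatio (α + 1) (γ + 1) m)) := by
      rw [pochRatio_succ']; ring
    have h0 : γ ≠ 0 := by simpa using hγ 0
    have hraise := add_mul_pochRatio_add_one (γ - α) hγ n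
    rw [Finset.sum_choose_succ_mul (fun m _ => (-1) ^ m * pochRatio α γ m), ih α hγ]
    simp only [hshift]
    rw [← Finset.mul_sum, ih (α + 1) hγ', add_sub_add_right_eq_sub, pochRatio_succ]
    have hn := hγ n
    field_simp
    linear_combination -α * hraise

theorem ascPochhammer_eval_nonneg {R : Type*} [Semiring R] [PartialOrder R] [IsOrderedRing R]
    {α : R} (hα : 0 ≤ α) (n : ℕ) : 0 ≤ (ascPochhammer R n).eval α := by
  induction n with
  | zero => simp
  | succ n ih =>
    rw [ascPochhammer_succ_eval]
    exact mul_nonneg ih (add_nonneg hα n.cast_nonneg)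

theorem pochRatio_nonneg {α γ : ℝ} (hα : 0 ≤ α) (hγ : 0 ≤ γ) (n : ℕ) : 0 ≤ pochRatio α γ n :=
  div_nonneg (ascPochhammer_eval_nonneg hα n) (ascPochhammer_eval_nonneg hγ n)

theorem pochRatio_le_one {α γ : ℝ} (hα : 0 ≤ α) (h : α ≤ γ) (n : ℕ) : pochRatio α γ n ≤ 1 := by
  induction n with
  | zero => rw [pochRatio_zero]
  | succ n ih =>
    have hγ := hα.trans h
    rw [pochRatio_succ]
    exact mul_le_one₀ ih (by positivity) (div_le_one_of_le₀ (by linarith) (by positivity))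

theorem summable_kummerM {α γ : ℝ} (hα : 0 ≤ α) (h : α ≤ γ) (x : ℝ) :
    Summable fun n : ℕ => pochRatio α γ n * (x ^ n / (n.factorial : ℝ)) := by
  refine .of_norm_bounded (summable_pow_div_factorial x).norm fun n => ?_
  rw [norm_mul, Real.norm_of_nonneg (pochRatio_nonneg hα (hα.trans h) n)]
  exact mul_le_of_le_one_left (norm_nonneg _) (pochRatio_le_one hα h n)

theorem kummerM_nonneg {α γ x : ℝ} (hα : 0 ≤ α) (hγ : 0 ≤ γ) (hx : 0 ≤ x) :
    0 ≤ kummerM α γ x :=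
  tsum_nonneg fun n => mul_nonneg (pochRatio_nonneg hα hγ n) (by positivity)

theorem hasSum_pow_div_factorial (x : ℝ) :
    HasSum (fun n : ℕ => x ^ n / (n.factorial : ℝ)) (exp x) := by
  rw [exp_eq_exp_ℝ]
  exact NormedSpace.expSeries_div_hasSum_exp x

theorem choose_mul_pow_div_factorial {K : Type*} [Field K] [CharZero K] (x : K) {m n : ℕ}
    (h : m ≤ n) :
    (n.choose m : K) * (x ^ n / (n.factorial : K)) =
      x ^ m / (m.factorial : K) * (x ^ (n - m) / ((n - m).factorial : K)) := by
  have hn : (n.factorial : K) ≠ 0 := Nat.cast_ne_zero.2 n.factorial_ne_zero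
  rw [Nat.cast_choose K h, ← pow_mul_pow_sub x h]
  field_simp

theorem exp_mul_kummerM_neg {α γ : ℝ} (hα : 0 ≤ α) (h : α ≤ γ) (hγ : 0 < γ) (x : ℝ) :
    exp x * kummerM α γ (-x) = kummerM (γ - α) γ x := by
  have hγ' (k : ℕ) : γ + k ≠ 0 := by positivity
  rw [mul_comm, ← (hasSum_pow_div_factorial x).tsum_eq, kummerM,
    tsum_mul_tsum_eq_tsum_sum_range_of_summable_norm (summable_kummerM hα h (-x)).norm
      (summable_pow_div_factorial x).norm]
  refine tsum_congr fun n => ?_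
  rw [← sum_choose_mul_neg_one_pow_mul_pochRatio α hγ' n, Finset.sum_mul]
  refine Finset.sum_congr rfl fun m hm => ?_
  rw [neg_pow]
  linear_combination -(-1) ^ m * pochRatio α γ m *
    choose_mul_pow_div_factorial x (Finset.mem_range_succ_iff.1 hm)

/-! ### Mixtures with confluent hypergeometric weights -/

/-- The weights `(α)_k / (γ)_k * a ^ k / k! * ₁F₁(α + k; γ + k; -a)` of the mixture of Gamma
distributions with shapes `α + k` that makes up the density. -/
def mixWeight (α γ a : ℝ) (k : ℕ) : ℝ :=
  pochRatio α γ k * (a ^ k / (k.factorial : ℝ)) * kummerM (α + k) (γ + k) (-a)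

theorem mixWeight_eq {α γ : ℝ} (hα : 0 ≤ α) (h : α ≤ γ) (hγ : 0 < γ) (a : ℝ) (k : ℕ) :
    mixWeight α γ a k =
      exp (-a) * (pochRatio α γ k * (a ^ k / (k.factorial : ℝ)) * kummerM (γ - α) (γ + k) a) := by
  have hkummer := exp_mul_kummerM_neg (α := α + k) (γ := γ + k) (by positivity) (by linarith)
    (by positivity) a
  rw [add_sub_add_right_eq_sub] at hkummer
  rw [mixWeight, ← hkummer, exp_neg]
  field_simp

theorem mixWeight_nonneg {α γ a : ℝ} (hα : 0 ≤ α) (h : α ≤ γ) (hγ : 0 < γ) (ha : 0 ≤ a) (k : ℕ) :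
    0 ≤ mixWeight α γ a k := by
  have hM : 0 ≤ kummerM (γ - α) (γ + k) a :=
    kummerM_nonneg (sub_nonneg.2 h) (by positivity) ha
  have hr := pochRatio_nonneg hα hγ.le k
  rw [mixWeight_eq hα h hγ]
  positivity

theorem hasSum_sum_antidiagonal {A M : Type*} [AddMonoid A] [Finset.HasAntidiagonal A]
    [AddCommMonoid M] [TopologicalSpace M] [ContinuousAdd M] [RegularSpace M] {f : A × A → M}
    {s : M} (hf : HasSum f s) :
    HasSum (fun n => ∑ i ∈ Finset.HasAntidiagonal.antidiagonal n, f i) s := by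
  refine HasSum.sigma
    (Finset.HasAntidiagonal.sigmaAntidiagonalEquivProd.hasSum_iff.2 hf) fun n => ?_
  rw [← Finset.sum_coe_sort]
  exact hasSum_fintype _

/-- The terms of the double series obtained by expanding the binomial sums in
`∑' n, (α)_n / (γ)_n * a ^ n / n! * ∑ m ≤ n, n.choose m * (-1) ^ m * g (n - m)`; the index is
`(m, n - m)`. -/
def mixTerm (α γ a : ℝ) (g : ℕ → ℝ) (i : ℕ × ℕ) : ℝ :=
  pochRatio α γ (i.2 + i.1) * ((-a) ^ i.1 / (i.1.factorial : ℝ) *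
    (a ^ i.2 / (i.2.factorial : ℝ) * g i.2))

theorem summable_mixTerm {α γ : ℝ} (hα : 0 ≤ α) (h : α ≤ γ) {a : ℝ} {g : ℕ → ℝ}
    (hg : Summable fun k : ℕ => a ^ k / (k.factorial : ℝ) * g k) :
    Summable (mixTerm α γ a g) := by
  refine .of_norm_bounded ((summable_pow_div_factorial (-a)).norm.mul_norm hg.norm) fun i => ?_
  rw [mixTerm, norm_mul, Real.norm_of_nonneg (pochRatio_nonneg hα (hα.trans h) _)]
  exact mul_le_of_le_one_left (norm_nonneg _) (pochRatio_le_one hα h _)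

theorem hasSum_mixTerm_fiber {α γ : ℝ} (hα : 0 ≤ α) (h : α ≤ γ) (a : ℝ) (g : ℕ → ℝ) (k : ℕ) :
    HasSum (fun j => mixTerm α γ a g (j, k)) (mixWeight α γ a k * g k) := by
  have hM := (summable_kummerM (α := α + k) (γ := γ + k) (by positivity) (by linarith)
    (-a)).hasSum.mul_left (pochRatio α γ k * (a ^ k / (k.factorial : ℝ)) * g k)
  rw [mixWeight, kummerM, mul_right_comm]
  refine hM.congr_fun fun j => ?_
  rw [mixTerm, pochRatio_add]
  ring

theorem sum_antidiagonal_mixTerm (α γ a : ℝ) (g : ℕ → ℝ) (n : ℕ) :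
    ∑ i ∈ Finset.HasAntidiagonal.antidiagonal n, mixTerm α γ a g i =
      pochRatio α γ n * (a ^ n / (n.factorial : ℝ)) *
        ∑ m ∈ Finset.range (n + 1), (n.choose m : ℝ) * ((-1) ^ m * g (n - m)) := by
  rw [Finset.Nat.sum_antidiagonal_eq_sum_range_succ_mk, Finset.mul_sum]
  refine Finset.sum_congr rfl fun m hm => ?_
  have hm := Finset.mem_range_succ_iff.1 hm
  simp only [mixTerm, Nat.sub_add_cancel hm, neg_pow a]
  linear_combination -pochRatio α γ n * (-1) ^ m * g (n - m) * choose_mul_pow_div_factorial a hm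

theorem summable_mixWeight_mul {α γ : ℝ} (hα : 0 ≤ α) (h : α ≤ γ) {a : ℝ} {g : ℕ → ℝ}
    (hg : Summable fun k : ℕ => a ^ k / (k.factorial : ℝ) * g k) :
    Summable fun k => mixWeight α γ a k * g k :=
  (((Equiv.prodComm ℕ ℕ).hasSum_iff.2 (summable_mixTerm hα h hg).hasSum).prod_fiberwise
    (hasSum_mixTerm_fiber hα h a g)).summable

theorem hasSum_pochRatio_mul_sum_choose {α γ : ℝ} (hα : 0 ≤ α) (h : α ≤ γ) {a : ℝ} {g : ℕ → ℝ}
    (hg : Summable fun k : ℕ => a ^ k / (k.factorial : ℝ) * g k) :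
    HasSum (fun n : ℕ => pochRatio α γ n * (a ^ n / (n.factorial : ℝ)) *
      ∑ m ∈ Finset.range (n + 1), (n.choose m : ℝ) * ((-1) ^ m * g (n - m)))
      (∑' k, mixWeight α γ a k * g k) := by
  have hsum := summable_mixTerm hα h hg
  have hswap := ((Equiv.prodComm ℕ ℕ).hasSum_iff.2 hsum.hasSum).prod_fiberwise
    (hasSum_mixTerm_fiber hα h a g)
  simpa only [sum_antidiagonal_mixTerm, hswap.tsum_eq] using hasSum_sum_antidiagonal hsum.hasSum

theorem hasSum_mixWeight_mul_pow {α γ : ℝ} (hα : 0 ≤ α) (h : α ≤ γ) (a x : ℝ) :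
    HasSum (fun k => mixWeight α γ a k * x ^ k) (kummerM α γ (a * (x - 1))) := by
  have hg : Summable fun k : ℕ => a ^ k / (k.factorial : ℝ) * x ^ k :=
    (summable_pow_div_factorial (a * x)).congr fun k => by rw [mul_pow]; ring
  have hkummer : kummerM α γ (a * (x - 1)) = ∑' k, mixWeight α γ a k * x ^ k := by
    rw [← (hasSum_pochRatio_mul_sum_choose hα h hg).tsum_eq, kummerM]
    refine tsum_congr fun n => ?_
    rw [show x - 1 = -1 + x by ring, mul_pow, add_pow]
    simp only [mul_comm _ (n.choose _ : ℝ)]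
    ring
  exact hkummer ▸ (summable_mixWeight_mul hα h hg).hasSum

/-! ### The density as a Gamma mixture -/

theorem gammaPDFReal_one_of_nonneg (α : ℝ) {t : ℝ} (ht : 0 ≤ t) :
    gammaPDFReal α 1 t = t ^ (α - 1) * exp (-t) / Gamma α := by
  rw [gammaPDFReal, if_pos ht, one_rpow, one_mul]
  ring

theorem ascPochhammer_eval_eq_Gamma_div {x : ℝ} (hx : 0 < x) (n : ℕ) :
    (ascPochhammer ℝ n).eval x = Gamma (x + n) / Gamma x := by
  have h0 := (Gamma_pos_of_pos hx).ne'
  induction n with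
  | zero => simp [h0]
  | succ n ih =>
    have hn : x + n ≠ 0 := by positivity
    rw [ascPochhammer_succ_eval, ih, Nat.cast_succ, ← add_assoc, Gamma_add_one hn]
    ring

theorem summable_pow_div_factorial_mul_gammaPDFReal (α a : ℝ) {t : ℝ} (ht : 0 < t) :
    Summable fun k : ℕ => a ^ k / (k.factorial : ℝ) * gammaPDFReal (α + k) 1 t := by
  refine .of_norm_bounded
    ((summable_pow_div_Gamma_add α (a * t)).mul_left (t ^ (α - 1) * exp (-t))).norm fun k => ?_
  have hterm : a ^ k / (k.factorial : ℝ) * gammaPDFReal (α + k) 1 t =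
      t ^ (α - 1) * exp (-t) * ((a * t) ^ k / Gamma (α + k)) / k.factorial := by
    rw [gammaPDFReal_one_of_nonneg _ ht.le, add_sub_right_comm, rpow_add_natCast ht.ne', mul_pow]
    ring
  rw [hterm, norm_div, norm_natCast]
  exact div_le_self (norm_nonneg _) (mod_cast k.factorial_pos)

theorem hasSum_mixWeight_mul_gammaPDFReal {α γ : ℝ} (hα : 0 < α) (h : α ≤ γ) (a : ℝ) {t : ℝ}
    (ht : 0 < t) :
    HasSum (fun k : ℕ => mixWeight α γ a k * gammaPDFReal (α + k) 1 t)
      (densityJet α γ t a 0) := by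
  have hγ := hα.trans_le h
  have hfiber (k : ℕ) : HasSum (fun j : ℕ => densityWeight α γ t a *
      (humbertCoeff (γ - α) γ (j, k) * (a ^ j * (a * t) ^ k)))
      (mixWeight α γ a k * gammaPDFReal (α + k) 1 t) := by
    have hle : γ - α ≤ γ + k := (sub_le_self γ hα.le).trans (le_add_of_nonneg_right k.cast_nonneg)
    have hM := (summable_kummerM (sub_nonneg.2 h) hle a).hasSum.mul_left
      (exp (-a) * (pochRatio α γ k * (a ^ k / (k.factorial : ℝ))) * gammaPDFReal (α + k) 1 t)
    rw [mixWeight_eq hα.le h hγ, kummerM, ← mul_assoc, mul_right_comm]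
    refine hM.congr_fun fun j => ?_
    have hγk : 0 < γ + k := add_pos_of_pos_of_nonneg hγ k.cast_nonneg
    have hΓα := (Gamma_pos_of_pos hα).ne'
    have hΓαk := (Gamma_pos_of_pos (add_pos_of_pos_of_nonneg hα k.cast_nonneg)).ne'
    have hΓγk := (Gamma_pos_of_pos hγk).ne'
    rw [gammaPDFReal_one_of_nonneg _ ht.le, add_sub_right_comm, rpow_add_natCast ht.ne', mul_pow,
      pochRatio, pochRatio, ascPochhammer_eval_eq_Gamma_div hα, ascPochhammer_eval_eq_Gamma_div hγ,
      ascPochhammer_eval_eq_Gamma_div hγk, humbertCoeff, densityWeight, add_right_comm γ j k]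
    field_simp
  have hsum := (hasSum_humbert (γ - α) γ a (a * t)).mul_left (densityWeight α γ t a)
  simpa [densityJet, humbertJet] using
    ((Equiv.prodComm ℕ ℕ).hasSum_iff.2 hsum).prod_fiberwise hfiber

theorem densityJet_zero_nonneg {α γ a t : ℝ} (hα : 0 < α) (h : α ≤ γ) (ha : 0 ≤ a) (ht : 0 < t) :
    0 ≤ densityJet α γ t a 0 :=
  (hasSum_mixWeight_mul_gammaPDFReal hα h a ht).nonneg fun k =>
    mul_nonneg (mixWeight_nonneg hα.le h (hα.trans_le h) ha k)
      (gammaPDFReal_nonneg (by positivity) one_pos t)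

theorem contDiffOn_densityJet_zero (α γ a : ℝ) :
    ContDiffOn ℝ ∞ (fun t => densityJet α γ t a 0) (Set.Ioi 0) := by
  have hhumbert : ContDiff ℝ ∞ fun t : ℝ => humbert (γ - α) γ a (a * t) :=
    (contDiff_humbert (γ - α) γ).comp (contDiff_const.prodMk (contDiff_const.mul contDiff_id))
  have hpow : ContDiffOn ℝ ∞ (fun t : ℝ => t ^ (α - 1)) (Set.Ioi 0) := fun t ht =>
    (contDiffAt_rpow_const_of_ne (Set.mem_Ioi.1 ht).ne').contDiffWithinAt
  have hweight : ContDiffOn ℝ ∞ (fun t => densityWeight α γ t a) (Set.Ioi 0) :=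
    contDiffOn_const.mul (contDiffOn_const.mul (hpow.mul contDiff_neg.exp.contDiffOn))
  simpa [densityJet, humbertJet] using hweight.mul hhumbert.contDiffOn

theorem integral_exp_mul_gammaPDFReal {α r s : ℝ} (hα : 0 < α) (hr : 0 ≤ r) (hs : s < r) :
    ∫ t in Set.Ioi (0 : ℝ), exp (s * t) * gammaPDFReal α r t = (r / (r - s)) ^ α := by
  have hG := (Gamma_pos_of_pos hα).ne'
  have hterm : ∀ t ∈ Set.Ioi (0 : ℝ), exp (s * t) * gammaPDFReal α r t =
      r ^ α / Gamma α * (t ^ (α - 1) * exp (-((r - s) * t))) := fun t ht => by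
    rw [gammaPDFReal, if_pos (Set.mem_Ioi.1 ht).le,
      show -((r - s) * t) = s * t + -(r * t) by ring, exp_add]
    ring
  rw [setIntegral_congr_fun measurableSet_Ioi hterm, integral_const_mul,
    integral_rpow_mul_exp_neg_mul_Ioi hα (sub_pos.2 hs), div_eq_mul_one_div r,
    mul_rpow hr (one_div_nonneg.2 (sub_pos.2 hs).le)]
  field_simp

theorem integrableOn_exp_mul_gammaPDFReal {α r s : ℝ} (hα : 0 < α) (hr : 0 < r) (hs : s < r) :
    IntegrableOn (fun t => exp (s * t) * gammaPDFReal α r t) (Set.Ioi 0) := by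
  refine Integrable.of_integral_ne_zero ?_
  rw [integral_exp_mul_gammaPDFReal hα hr.le hs]
  exact (rpow_pos_of_pos (div_pos hr (sub_pos.2 hs)) α).ne'

theorem integrable_of_hasSum_of_summable_integral_norm {X ι E : Type*} [MeasurableSpace X]
    [NormedAddCommGroup E] {μ : Measure X} [Countable ι] {F : ι → X → E} {f : X → E}
    (hF : ∀ i, Integrable (F i) μ) (hsum : Summable fun i => ∫ x, ‖F i x‖ ∂μ)
    (hf : ∀ᵐ x ∂μ, HasSum (fun i => F i x) (f x)) : Integrable f μ := by
  refine ⟨aestronglyMeasurable_of_tendsto_ae Filter.atTop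
    (fun S => Finset.aestronglyMeasurable_fun_sum S fun i _ => (hF i).aestronglyMeasurable) hf, ?_⟩
  calc ∫⁻ x, ‖f x‖ₑ ∂μ ≤ ∫⁻ x, ∑' i, ‖F i x‖ₑ ∂μ :=
        lintegral_mono_ae (hf.mono fun x hx => hx.tsum_eq ▸ enorm_tsum_le_tsum_enorm)
    _ = ∑' i, ENNReal.ofReal (∫ x, ‖F i x‖ ∂μ) := by
        rw [lintegral_tsum fun i => (hF i).aestronglyMeasurable.enorm]
        simp only [ofReal_integral_norm_eq_lintegral_enorm (hF _)]
    _ < ⊤ := hsum.tsum_ofReal_ne_top.lt_top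

theorem integrableOn_and_integral_exp_mul_of_hasSum_gammaPDFReal {α s m : ℝ} {w : ℕ → ℝ}
    {f : ℝ → ℝ} (hα : 0 < α) (hs : s < 1) (hw : HasSum (fun k => w k * (1 / (1 - s)) ^ k) m)
    (hf : ∀ t > 0, HasSum (fun k => w k * gammaPDFReal (α + k) 1 t) (f t)) :
    IntegrableOn (fun t => exp (s * t) * f t) (Set.Ioi 0) ∧
      ∫ t in Set.Ioi (0 : ℝ), exp (s * t) * f t = (1 / (1 - s)) ^ α * m := by
  have hx : 0 < 1 / (1 - s) := one_div_pos.2 (sub_pos.2 hs)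
  have hshape (k : ℕ) : 0 < α + k := by positivity
  have hint (v : ℝ) (k : ℕ) : ∫ t in Set.Ioi (0 : ℝ), v * (exp (s * t) *
      gammaPDFReal (α + k) 1 t) = (1 / (1 - s)) ^ α * (v * (1 / (1 - s)) ^ k) := by
    rw [integral_const_mul, integral_exp_mul_gammaPDFReal (hshape k) zero_le_one hs,
      rpow_add_natCast hx.ne']
    ring
  let F (k : ℕ) (t : ℝ) : ℝ := w k * (exp (s * t) * gammaPDFReal (α + k) 1 t)
  have hF (k : ℕ) : IntegrableOn (F k) (Set.Ioi 0) :=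
    (integrableOn_exp_mul_gammaPDFReal (hshape k) one_pos hs).const_mul _
  have hnorm (k : ℕ) : ∫ t in Set.Ioi (0 : ℝ), ‖F k t‖ =
      (1 / (1 - s)) ^ α * ‖w k * (1 / (1 - s)) ^ k‖ := by
    have hpdf (t : ℝ) := gammaPDFReal_nonneg (hshape k) one_pos t
    simp only [F, norm_mul, norm_of_nonneg (exp_pos _).le, norm_of_nonneg (hpdf _), hint,
      norm_of_nonneg (pow_pos hx k).le]
  have hsum : Summable fun k => ∫ t in Set.Ioi (0 : ℝ), ‖F k t‖ := by
    simpa only [hnorm] using hw.summable.norm.mul_left _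
  have hval : HasSum (fun k => ∫ t in Set.Ioi (0 : ℝ), F k t) ((1 / (1 - s)) ^ α * m) := by
    simpa only [F, hint] using hw.mul_left _
  have hfF : ∀ t ∈ Set.Ioi (0 : ℝ), HasSum (fun k => F k t) (exp (s * t) * f t) := fun t ht =>
    ((hf t ht).mul_left _).congr_fun fun k => mul_left_comm _ _ _
  refine ⟨integrable_of_hasSum_of_summable_integral_norm hF hsum
    (ae_restrict_of_forall_mem measurableSet_Ioi hfF), ?_⟩
  rw [← (hasSum_integral_of_summable_integral_norm hF hsum).unique hval]
  exact setIntegral_congr_fun measurableSet_Ioi fun t ht => (hfF t ht).tsum_eq.symm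

theorem integrableOn_and_integral_exp_mul_densityJet_zero {α γ : ℝ} (hα : 0 < α) (h : α ≤ γ)
    (a : ℝ) {s : ℝ} (hs : s < 1) :
    IntegrableOn (fun t => exp (s * t) * densityJet α γ t a 0) (Set.Ioi 0) ∧
      ∫ t in Set.Ioi (0 : ℝ), exp (s * t) * densityJet α γ t a 0 =
        (1 / (1 - s)) ^ α * kummerM α γ (a * s / (1 - s)) := by
  have h1s : 1 - s ≠ 0 := (sub_pos.2 hs).ne'
  have harg : a * s / (1 - s) = a * (1 / (1 - s) - 1) := by
    field_simp
    ring
  rw [harg]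
  exact integrableOn_and_integral_exp_mul_of_hasSum_gammaPDFReal hα hs
    (hasSum_mixWeight_mul_pow hα.le h a _) fun t ht => hasSum_mixWeight_mul_gammaPDFReal hα h a ht

/-! ### The signal-to-noise ratio -/

theorem pow_mul_exp_div_factorial_eq_gammaPDFReal {n : ℕ} (hn : 1 ≤ n) {t : ℝ} (ht : 0 ≤ t) :
    t ^ (n - 1) * exp (-t) / ((n - 1).factorial : ℝ) = gammaPDFReal n 1 t := by
  obtain ⟨n, rfl⟩ := Nat.exists_eq_add_of_le' hn
  rw [gammaPDFReal_one_of_nonneg _ ht, Nat.add_sub_cancel, Nat.cast_succ, Gamma_nat_eq_factorial,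
    add_sub_cancel_right, rpow_natCast]

theorem hasSum_pdfTerm {N NR : ℕ} (hN : 1 ≤ N) (hNR : N ≤ NR) (a : ℝ) {t : ℝ} (ht : 0 < t) :
    HasSum (pdfTerm N NR t a) (densityJet N NR t a 0) := by
  have hα : (0 : ℝ) < N := mod_cast hN
  have hαγ : (N : ℝ) ≤ NR := mod_cast hNR
  rw [(hasSum_mixWeight_mul_gammaPDFReal hα hαγ a ht).tsum_eq.symm]
  refine (hasSum_pochRatio_mul_sum_choose hα.le hαγ
    (summable_pow_div_factorial_mul_gammaPDFReal N a ht)).congr_fun fun n => ?_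
  refine congrArg _ (Finset.sum_congr rfl fun m hm => ?_)
  have hmn : N + n - m = N + (n - m) := Nat.add_sub_assoc (Finset.mem_range_succ_iff.1 hm) N
  rw [hmn, mul_assoc, mul_div_assoc,
    pow_mul_exp_div_factorial_eq_gammaPDFReal (hN.trans (N.le_add_right _)) ht.le, Nat.cast_add]

theorem snrPdf_eq_densityJet {N NR : ℕ} (hN : 1 ≤ N) (hNR : N ≤ NR) (a : ℝ) :
    Set.EqOn (fun t => snrPdf N NR t a) (fun t => densityJet N NR t a 0) (Set.Ioi 0) :=
  fun _ ht => (hasSum_pdfTerm hN hNR a ht).tsum_eq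

theorem snrMgf_eq (N NR : ℕ) (s a : ℝ) :
    snrMgf N NR s a = (1 / (1 - s)) ^ (N : ℝ) * kummerM N NR (a * s / (1 - s)) := by
  rw [snrMgf, rpow_natCast, one_div_pow]
  rfl

theorem integrableOn_and_integral_exp_mul_snrPdf {N NR : ℕ} (hN : 1 ≤ N) (hNR : N ≤ NR) (a : ℝ)
    {s : ℝ} (hs : s < 1) :
    IntegrableOn (fun t => exp (s * t) * snrPdf N NR t a) (Set.Ioi 0) ∧
      ∫ t in Set.Ioi (0 : ℝ), exp (s * t) * snrPdf N NR t a = snrMgf N NR s a := by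
  have heq : ∀ t ∈ Set.Ioi (0 : ℝ), exp (s * t) * snrPdf N NR t a =
      exp (s * t) * densityJet N NR t a 0 := fun t ht =>
    congrArg (exp (s * t) * ·) (snrPdf_eq_densityJet hN hNR a ht)
  rw [integrableOn_congr_fun heq measurableSet_Ioi, setIntegral_congr_fun measurableSet_Ioi heq,
    snrMgf_eq]
  exact integrableOn_and_integral_exp_mul_densityJet_zero (mod_cast hN) (mod_cast hNR) a hs

theorem hasDerivAt_densityJet_fst (α γ a : ℝ) {t : ℝ} (ht : 0 < t) :
    HasDerivAt (fun v => densityJet α γ v a) ((matP α γ t a).mulVec (densityJet α γ t a)) t := by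
  simpa using hasDerivAt_densityJet α γ (ρ := 0) (hasDerivAt_id t)
    ((hasDerivAt_const t a).congr_deriv (mul_zero a).symm) ht

theorem iteratedDeriv_densityJet_zero (α γ a : ℝ) (q : Fin 3) :
    Set.EqOn (iteratedDeriv q fun v => densityJet α γ v a 0) (fun v => densityJet α γ v a q)
      (Set.Ioi 0) := by
  have hderiv {t : ℝ} (ht : 0 < t) (q : Fin 3) :=
    (hasDerivAt_pi.1 (hasDerivAt_densityJet_fst α γ a ht) q).deriv
  have h1 : Set.EqOn (deriv fun v => densityJet α γ v a 0) (fun v => densityJet α γ v a 1)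
      (Set.Ioi 0) := fun t ht => by
    simpa [matP, Matrix.mulVec, dotProduct, Fin.sum_univ_three] using hderiv ht 0
  have h2 : Set.EqOn (deriv fun v => densityJet α γ v a 1) (fun v => densityJet α γ v a 2)
      (Set.Ioi 0) := fun t ht => by
    simpa [matP, Matrix.mulVec, dotProduct, Fin.sum_univ_three] using hderiv ht 1
  fin_cases q
  · exact fun t _ => congrFun iteratedDeriv_zero t
  · simpa [iteratedDeriv_one] using h1
  · simpa [iteratedDeriv_succ, iteratedDeriv_zero] using (h1.deriv isOpen_Ioi).trans h2

theorem pVec_eq_densityJet {N NR : ℕ} (hN : 1 ≤ N) (hNR : N ≤ NR) (a : ℝ) {t : ℝ} (ht : 0 < t) :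
    pVec N NR t a = densityJet N NR t a := by
  funext q
  exact ((snrPdf_eq_densityJet hN hNR a).iteratedDeriv_of_isOpen isOpen_Ioi q ht).trans
    (iteratedDeriv_densityJet_zero N NR a q ht)

/-! ### The system along a line -/

theorem hasDerivAt_pLine {N NR : ℕ} (hN : 1 ≤ N) (hNR : N ≤ NR) (c : ℝ) {u : ℝ} (hu : 0 < u) :
    HasDerivAt (pLine N NR c) ((lineMatrix N NR c u).mulVec (pLine N NR c u)) u := by
  have hline : HasDerivAt (fun v => c * v) (c * u * (1 / u)) u :=
    ((hasDerivAt_id u).const_mul c).congr_deriv (by field_simp)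
  have hjet : Set.EqOn (pLine N NR c) (fun v => densityJet N NR v (c * v)) (Set.Ioi 0) :=
    fun v hv => pVec_eq_densityJet hN hNR (c * v) hv
  rw [hjet hu]
  refine HasDerivAt.congr_of_eventuallyEq ?_ (hjet.eventuallyEq_of_mem (Ioi_mem_nhds hu))
  simpa only [lineMatrix, one_smul, id] using
    hasDerivAt_densityJet N NR (hasDerivAt_id u) hline hu

theorem continuousOn_lineMatrix (N NR : ℕ) (c : ℝ) :
    ContinuousOn (lineMatrix N NR c) (Set.Ioi 0) := by
  intro u hu
  have hu : u ≠ 0 := (Set.mem_Ioi.1 hu).ne'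
  have hu2 : u ^ 2 ≠ 0 := pow_ne_zero 2 hu
  have hof : Continuous (Matrix.of (m := Fin 3) (n := Fin 3) (α := ℝ)) := continuous_id
  have hP : ContinuousAt (fun v => matP N NR v (c * v)) u := by
    refine ContinuousAt.comp (g := Matrix.of) hof.continuousAt ?_
    fun_prop (disch := assumption)
  have hQ : ContinuousAt (fun v => matQ N NR v (c * v)) u := by
    refine ContinuousAt.comp (g := Matrix.of) hof.continuousAt ?_
    fun_prop (disch := assumption)
  unfold lineMatrix
  exact (hP.add ((continuousAt_const.div continuousAt_id hu).smul hQ)).continuousWithinAt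

theorem eqOn_of_hasDerivWithinAt_clm {E : Type*} [NormedAddCommGroup E] [NormedSpace ℝ E]
    {A : ℝ → E →L[ℝ] E} {f g : ℝ → E} {a b : ℝ} (hA : ContinuousOn A (Set.Icc a b))
    (hf : ∀ t ∈ Set.Icc a b, HasDerivWithinAt f (A t (f t)) (Set.Icc a b) t)
    (hg : ∀ t ∈ Set.Icc a b, HasDerivWithinAt g (A t (g t)) (Set.Icc a b) t)
    (h : f a = g a) : Set.EqOn f g (Set.Icc a b) := by
  obtain ⟨C, hC⟩ := isCompact_Icc.exists_bound_of_continuousOn hA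
  have hright {F : ℝ → E}
      (hF : ∀ t ∈ Set.Icc a b, HasDerivWithinAt F (A t (F t)) (Set.Icc a b) t) :
      ∀ t ∈ Set.Ico a b, HasDerivWithinAt F (A t (F t)) (Set.Ici t) t := fun t ht =>
    (hF t (Set.Ico_subset_Icc_self ht)).mono_of_mem_nhdsWithin (Icc_mem_nhdsGE_of_mem ht)
  have hlip : ∀ t ∈ Set.Ico a b, LipschitzOnWith C.toNNReal (A t) Set.univ := fun t ht =>
    ((A t).lipschitz.weaken (NNReal.coe_le_coe.1 ((hC t (Set.Ico_subset_Icc_self ht)).trans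
      (le_coe_toNNReal C)))).lipschitzOnWith
  exact ODE_solution_unique_of_mem_Icc_right hlip
    (fun t ht => (hf t ht).continuousWithinAt) (hright hf) (fun _ _ => Set.mem_univ _)
    (fun t ht => (hg t ht).continuousWithinAt) (hright hg) (fun _ _ => Set.mem_univ _) h

theorem eqOn_of_hasDerivWithinAt_mulVec {n : Type*} [Fintype n] {A : ℝ → Matrix n n ℝ}
    {f g : ℝ → n → ℝ} {a b : ℝ} (hA : ContinuousOn A (Set.Icc a b))
    (hf : ∀ t ∈ Set.Icc a b, HasDerivWithinAt f ((A t).mulVec (f t)) (Set.Icc a b) t)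
    (hg : ∀ t ∈ Set.Icc a b, HasDerivWithinAt g ((A t).mulVec (g t)) (Set.Icc a b) t)
    (h : f a = g a) : Set.EqOn f g (Set.Icc a b) := by
  classical
  let toCLM : Matrix n n ℝ →ₗ[ℝ] (n → ℝ) →L[ℝ] n → ℝ :=
    LinearMap.toContinuousLinearMap.toLinearMap ∘ₗ Matrix.toLin'.toLinearMap
  exact eqOn_of_hasDerivWithinAt_clm (A := fun t => toCLM (A t))
    (toCLM.continuous_of_finiteDimensional.comp_continuousOn hA) hf hg h

end ZFSNR

end

theorem mainTheorem6_general (NR N : ℕ) (hN : 1 ≤ N) (hNR : N ≤ NR) :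
    (∀ a : ℝ,
      (∀ t : ℝ, 0 < t → Summable (ZFSNR.pdfTerm N NR t a) ∧ (0 ≤ a → 0 ≤ ZFSNR.snrPdf N NR t a)) ∧
      ContDiffOn ℝ ∞ (fun t => ZFSNR.snrPdf N NR t a) (Set.Ioi 0) ∧
      ∀ s : ℝ, s < 1 →
        Summable (fun n => ZFSNR.hypTerm N NR n (a * s / (1 - s))) ∧
        MeasureTheory.IntegrableOn
          (fun t => Real.exp (s * t) * ZFSNR.snrPdf N NR t a) (Set.Ioi 0) ∧
        ∫ t in Set.Ioi (0 : ℝ), Real.exp (s * t) * ZFSNR.snrPdf N NR t a =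
          ZFSNR.snrMgf N NR s a) ∧
    ∀ c : ℝ,
      (∀ u : ℝ, 0 < u →
        HasDerivAt (ZFSNR.pLine N NR c)
          ((ZFSNR.lineMatrix N NR c u).mulVec (ZFSNR.pLine N NR c u)) u) ∧
      (∀ u₀ u₁ : ℝ, 0 < u₀ → ∀ y : ℝ → Fin 3 → ℝ,
        y u₀ = ZFSNR.pLine N NR c u₀ →
        (∀ u ∈ Set.Icc u₀ u₁,
          HasDerivWithinAt y ((ZFSNR.lineMatrix N NR c u).mulVec (y u)) (Set.Icc u₀ u₁) u) →
        Set.EqOn y (ZFSNR.pLine N NR c) (Set.Icc u₀ u₁)) := by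
  have hα : (0 : ℝ) < N := mod_cast hN
  have hαγ : (N : ℝ) ≤ NR := mod_cast hNR
  refine ⟨fun a => ⟨fun t ht => ⟨(ZFSNR.hasSum_pdfTerm hN hNR a ht).summable, fun ha => ?_⟩,
    ?_, fun s hs => ⟨ZFSNR.summable_kummerM hα.le hαγ _,
      ZFSNR.integrableOn_and_integral_exp_mul_snrPdf hN hNR a hs⟩⟩,
    fun c => ⟨fun u hu => ZFSNR.hasDerivAt_pLine hN hNR c hu, fun u₀ u₁ hu₀ y hy₀ hy => ?_⟩⟩
  · exact (ZFSNR.densityJet_zero_nonneg hα hαγ ha ht).trans_eq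
      (ZFSNR.snrPdf_eq_densityJet hN hNR a ht).symm
  · exact (ZFSNR.contDiffOn_densityJet_zero N NR a).congr (ZFSNR.snrPdf_eq_densityJet hN hNR a)
  · have hpos : Set.Icc u₀ u₁ ⊆ Set.Ioi 0 := fun u hu => hu₀.trans_le hu.1
    exact ZFSNR.eqOn_of_hasDerivWithinAt_mulVec
      ((ZFSNR.continuousOn_lineMatrix N NR c).mono hpos) hy
      (fun u hu => (ZFSNR.hasDerivAt_pLine hN hNR c (hpos hu)).hasDerivWithinAt) hy₀

theorem mainTheorem6 (NT NR N : ℕ) (hNT : 1 ≤ NT) (hNR : NT ≤ NR) (hN : N = NR - NT + 1) :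
    -- the series converges and is a smooth probability density on `(0, ∞)` with m.g.f. `M(·, a)`
    (∀ a : ℝ, 0 ≤ a →
      (∀ t : ℝ, 0 < t → Summable (ZFSNR.pdfTerm N NR t a) ∧ 0 ≤ ZFSNR.snrPdf N NR t a) ∧
      ContDiffOn ℝ ∞ (fun t => ZFSNR.snrPdf N NR t a) (Set.Ioi 0) ∧
      ∀ s : ℝ, s < 1 →
        Summable (fun n => ZFSNR.hypTerm N NR n (a * s / (1 - s))) ∧
        MeasureTheory.IntegrableOn
          (fun t => Real.exp (s * t) * ZFSNR.snrPdf N NR t a) (Set.Ioi 0) ∧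
        ∫ t in Set.Ioi (0 : ℝ), Real.exp (s * t) * ZFSNR.snrPdf N NR t a =
          ZFSNR.snrMgf N NR s a) ∧
    ∀ c : ℝ, 0 ≤ c →
      -- the system of differential equations on the line `a = c t`
      (∀ u : ℝ, 0 < u →
        HasDerivAt (ZFSNR.pLine N NR c)
          ((ZFSNR.lineMatrix N NR c u).mulVec (ZFSNR.pLine N NR c u)) u) ∧
      -- solving that system from the initial condition at `u₀` returns the function vector
      (∀ u₀ u₁ : ℝ, 0 < u₀ → u₀ ≤ u₁ → ∀ y : ℝ → Fin 3 → ℝ,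
        y u₀ = ZFSNR.pLine N NR c u₀ →
        (∀ u ∈ Set.Icc u₀ u₁,
          HasDerivWithinAt y ((ZFSNR.lineMatrix N NR c u).mulVec (y u)) (Set.Icc u₀ u₁) u) →
        Set.EqOn y (ZFSNR.pLine N NR c) (Set.Icc u₀ u₁)) := by
  obtain ⟨hpdf, hode⟩ := mainTheorem6_general NR N (by omega) (by omega)
  exact ⟨fun a ha => ⟨fun t ht => ((hpdf a).1 t ht).imp_right (· ha), (hpdf a).2⟩,
    fun c _ => (hode c).imp_right fun h u₀ u₁ hu₀ _ => h u₀ u₁ hu₀⟩
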